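/- For a group $G$ and an endomorphism $\varphi$ of $G$, call $x, y \in G$ $\varphi$-conjugate if $x = z y \varphi(z)^{-1}$ for some $z \in G$. This is an equivalence relation on $G$; let $R(\varphi) \in \{1, 2, 3, \ldots\} \cup \{\infty\}$ be the number of its classes, let $\mathrm{Spec}_R(G) = \{R(\psi) \mid \psi \in \mathrm{Aut}(G)\}$, and say that $G$ has full Reidemeister spectrum if $\mathrm{Spec}_R(G) = \{1, 2, 3, \ldots\} \cup \{\infty\}$. Let $N$ be a finitely generated torsion-free nilpotent group and let $H$ be a characteristic subgroup of $N$ of finite index. Then $\mathrm{Spec}_R(N) \subseteq \mathrm{Spec}_R(H)$. In particular, if $N$ has full Reidemeister spectrum, then so does $H$. -/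

import Mathlib

/-- `φ`-conjugacy on a group `G`: `x ∼ y` iff `x = z * y * (φ z)⁻¹` for some `z`. -/
def twistedConjSetoid {G : Type*} [Group G] (φ : Monoid.End G) : Setoid G where
  r x y := ∃ z : G, x = z * y * (φ z)⁻¹
  iseqv :=
    { refl := fun x => ⟨1, by simp⟩
      symm := by
        rintro x y ⟨z, rfl⟩
        exact ⟨z⁻¹, by simp [mul_assoc]⟩
      trans := by
        rintro x y w ⟨z, rfl⟩ ⟨z', rfl⟩
        exact ⟨z * z', by simp [mul_assoc]⟩ }

/-- The Reidemeister number of an endomorphism `φ`: the number of `φ`-conjugacy classes,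
`⊤` if there are infinitely many. -/
noncomputable def reidemeisterNumber {G : Type*} [Group G] (φ : Monoid.End G) : ℕ∞ :=
  ENat.card (Quotient (twistedConjSetoid φ))

/-- The Reidemeister spectrum: the set of Reidemeister numbers of automorphisms. -/
def reidemeisterSpectrum (G : Type*) [Group G] : Set ℕ∞ :=
  {n | ∃ ψ : MulAut G, reidemeisterNumber (ψ.toMonoidHom : Monoid.End G) = n}

/-- Full Reidemeister spectrum: the spectrum consists of all positive integers and `∞`. -/
def HasFullReidemeisterSpectrum (G : Type*) [Group G] : Prop :=
  reidemeisterSpectrum G = {n : ℕ∞ | ∃ k : ℕ, 1 ≤ k ∧ n = (k : ℕ∞)} ∪ {⊤}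

/-- A group is torsion-free if its only element of finite order is the identity. -/
def IsTorsionFreeGroup (G : Type*) [Group G] : Prop :=
  ∀ g : G, IsOfFinOrder g → g = 1

open scoped commutatorElement

/-! ### Subgroups of finitely generated nilpotent groups -/

/-! An automorphism `φ` of `N` restricts to `H` with the same Reidemeister number. The proof is by
induction along `G ⧸ center G`, where `φ` induces `ψ`. If `R(ψ) = ∞`, the numbers for `G` and for
`H` are both infinite, since each surjects onto an infinite set of classes. If `R(ψ)` is finite,
twisted stabilizers of `ψ` are trivial, so `R(φ)` is the product of `R(ψ)` and the number on the
centre (`natCard_twistedConj_eq_mul`); the same holds for `H`, an extension of its image by `H ⊓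
center G`. On the centre the number is the index of the image of `a ↦ a * (φ a)⁻¹`, and passing to
an invariant subgroup of finite index preserves it (`Subgroup.relIndex_map_eq_index_range`). The
centre is finitely generated because all subgroups of `N` are. -/

theorem Subgroup.exists_fg_le_map_eq {G Q : Type*} [Group G] [Group Q] (f : G →* Q)
    (M : Subgroup G) (h : (M.map f).FG) : ∃ F ≤ M, F.FG ∧ F.map f = M.map f := by
  classical
  obtain ⟨S, hS⟩ := h
  have hsub : (S : Set Q) ⊆ f '' (M : Set G) := by
    rw [← Subgroup.coe_map, ← hS]; exact Subgroup.subset_closure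
  obtain ⟨T, hT, rfl⟩ := Finset.subset_set_image_iff.1 hsub
  refine ⟨Subgroup.closure T, (Subgroup.closure_le _).2 hT, ⟨T, rfl⟩, ?_⟩
  rw [MonoidHom.map_closure, ← hS, Finset.coe_image]

theorem Subgroup.fg_of_fg_map_of_fg_inf_ker {G Q : Type*} [Group G] [Group Q] (f : G →* Q)
    (M : Subgroup G) (h : (M.map f).FG) (hk : (M ⊓ f.ker).FG) : M.FG := by
  obtain ⟨F, hFM, hF, hmap⟩ := Subgroup.exists_fg_le_map_eq f M h
  have : M = F ⊔ (M ⊓ f.ker) := by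
    refine le_antisymm (fun x hx => ?_) (sup_le hFM inf_le_left)
    have : f x ∈ F.map f := hmap ▸ Subgroup.mem_map_of_mem f hx
    obtain ⟨y, hy, hyx⟩ := this
    have hk' : y⁻¹ * x ∈ M ⊓ f.ker :=
      ⟨M.mul_mem (M.inv_mem (hFM hy)) hx, by simp [hyx]⟩
    have := Subgroup.mul_mem_sup hy hk'
    simpa using this
  rw [this]
  exact hF.sup hk

theorem Subgroup.fg_of_commGroup_fg {A : Type*} [CommGroup A] [Group.FG A] (B : Subgroup A) :
    B.FG := by
  have : Module.Finite ℤ (Additive A) := by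
    rw [Module.Finite.iff_addGroup_fg]
    infer_instance
  have h := IsNoetherian.noetherian (AddSubgroup.toIntSubmodule B.toAddSubgroup)
  rw [Submodule.fg_iff_addSubgroup_fg] at h
  rw [Subgroup.fg_iff_add_fg]
  simpa using h

theorem Subgroup.fg_of_le_center_of_le {G : Type*} [Group G] {L K : Subgroup G}
    (hL : L ≤ Subgroup.center G) (hfg : L.FG) (hK : K ≤ L) : K.FG := by
  let _ : CommGroup L :=
    { mul_comm := fun a b => Subtype.ext ((Subgroup.mem_center_iff.1 (hL b.2) a)) }
  have : Group.FG L := (Group.fg_iff_subgroup_fg L).2 hfg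
  have h := Subgroup.fg_of_commGroup_fg (K.subgroupOf L)
  have : Group.FG (K.subgroupOf L) := (Group.fg_iff_subgroup_fg _).2 h
  exact (Group.fg_iff_subgroup_fg K).1
    (Group.fg_of_surjective (f := (Subgroup.subgroupOfEquivOfLe hK).toMonoidHom)
      (Subgroup.subgroupOfEquivOfLe hK).surjective)

/-- If `L = ⁅M, ⊤⁆` is central and the image of `M` in `G ⧸ L` is finitely generated, then so is
`L`, by the commutators of generators. -/
theorem Subgroup.fg_commutator_top_of_le_center {G : Type*} [Group G] [Group.FG G]
    (M : Subgroup G) [M.Normal] (hL : ⁅M, (⊤ : Subgroup G)⁆ ≤ Subgroup.center G)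
    (hM : (M.map (QuotientGroup.mk' ⁅M, (⊤ : Subgroup G)⁆)).FG) :
    ⁅M, (⊤ : Subgroup G)⁆.FG := by
  set L := ⁅M, (⊤ : Subgroup G)⁆ with hLdef
  obtain ⟨F, hFM, ⟨S, rfl⟩, hmap⟩ := Subgroup.exists_fg_le_map_eq _ M hM
  obtain ⟨T, hT⟩ := Group.fg_def.1 ‹Group.FG G›
  have hfin : (Set.image2 (fun s t : G => ⁅s, t⁆) S T).Finite :=
    Set.Finite.image2 _ S.finite_toSet T.finite_toSet
  let K := Subgroup.closure (Set.image2 (fun s t : G => ⁅s, t⁆) (S : Set G) T)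
  have hKL : K ≤ L := by
    rw [Subgroup.closure_le]
    rintro _ ⟨s, hs, t, -, rfl⟩
    exact Subgroup.commutator_mem_commutator (hFM (Subgroup.subset_closure hs)) (Subgroup.mem_top _)
  have hKZ : K ≤ Subgroup.center G := hKL.trans hL
  have : K.Normal := ⟨fun n hn g => by
    rw [Subgroup.mem_center_iff.1 (hKZ hn) g, mul_inv_cancel_right]; exact hn⟩
  let q := QuotientGroup.mk' K
  let C := (Subgroup.center (G ⧸ K)).comap q
  have hcomm : ∀ a b : G, ⁅a, b⁆ ∈ K → q b * q a = q a * q b := by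
    intro a b h
    have : q ⁅a, b⁆ = 1 := (QuotientGroup.eq_one_iff _).2 h
    rw [map_commutatorElement, commutatorElement_eq_one_iff_mul_comm] at this
    exact this.symm
  -- Modulo `K`, each `s` commutes with the generators `T`, so it is central. As `M` is generated by
  -- `S` and `L`, all of `M` is central modulo `K`, which forces `L ≤ K`.
  have hSC : Subgroup.closure (S : Set G) ≤ C := by
    rw [Subgroup.closure_le]
    intro s hs
    have h1 : (⊤ : Subgroup G) ≤ (Subgroup.centralizer {q s}).comap q := by
      rw [← hT, Subgroup.closure_le]
      intro t ht
      have := hcomm s t (Subgroup.subset_closure ⟨s, hs, t, ht, rfl⟩)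
      simp only [Subgroup.coe_comap, Set.mem_preimage, SetLike.mem_coe,
        Subgroup.mem_centralizer_singleton_iff]
      exact this
    refine Subgroup.mem_center_iff.2 fun y => ?_
    obtain ⟨g, rfl⟩ := QuotientGroup.mk'_surjective K y
    have := h1 (Subgroup.mem_top g)
    simp only [Subgroup.mem_comap, Subgroup.mem_centralizer_singleton_iff] at this
    exact this
  have hLC : L ≤ C := fun l hl => Subgroup.mem_center_iff.2 fun y => by
    obtain ⟨g, rfl⟩ := QuotientGroup.mk'_surjective K y
    rw [← map_mul, ← map_mul, Subgroup.mem_center_iff.1 (hL hl) g]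
  have hMC : M ≤ C := by
    intro x hx
    have : QuotientGroup.mk' L x ∈ (Subgroup.closure (S : Set G)).map (QuotientGroup.mk' L) :=
      hmap ▸ Subgroup.mem_map_of_mem _ hx
    obtain ⟨y, hy, hyx⟩ := this
    have hl : y⁻¹ * x ∈ L := QuotientGroup.eq.1 hyx
    simpa using C.mul_mem (hSC hy) (hLC hl)
  have hLK : L ≤ K := by
    rw [hLdef, Subgroup.commutator_le]
    intro a ha b _
    rw [← QuotientGroup.eq_one_iff]
    change q ⁅a, b⁆ = 1
    rw [map_commutatorElement, commutatorElement_eq_one_iff_mul_comm]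
    exact (Subgroup.mem_center_iff.1 (hMC ha) _).symm
  rw [le_antisymm hLK hKL]
  exact (Subgroup.fg_iff _).2 ⟨_, rfl, hfin⟩

theorem Subgroup.fg_of_lowerCentralSeries_eq_bot (n : ℕ) : ∀ (G : Type*) [Group G] [Group.FG G],
    (⊤ : Subgroup G).lowerCentralSeries n = ⊥ → ∀ K : Subgroup G, K.FG := by
  induction n with
  | zero =>
    intro G _ _ h K
    have : K = ⊥ := le_bot_iff.1 (by
      rw [← h, Subgroup.lowerCentralSeries_zero]; exact le_top)
    rw [this]
    exact ⟨∅, by simp⟩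
  | succ n ih =>
    intro G _ _ h K
    set L := (⊤ : Subgroup G).lowerCentralSeries n with hLdef
    have hLZ : L ≤ Subgroup.center G := by
      intro x hx
      refine Subgroup.mem_center_iff.2 fun g => ?_
      have h1 : ⁅x, g⁆ ∈ (⊤ : Subgroup G).lowerCentralSeries (n + 1) := by
        rw [Subgroup.lowerCentralSeries_succ]
        exact Subgroup.commutator_mem_commutator hx (Subgroup.mem_top _)
      rw [h, Subgroup.mem_bot, commutatorElement_eq_one_iff_mul_comm] at h1
      exact h1.symm
    have : L.Normal := ⟨fun x hx g => by
      rw [Subgroup.mem_center_iff.1 (hLZ hx) g, mul_inv_cancel_right]; exact hx⟩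
    have hQ : ∀ J : Subgroup (G ⧸ L), J.FG := by
      refine ih (G ⧸ L) ?_
      have := Subgroup.map_lowerCentralSeries (S := (⊤ : Subgroup G)) (QuotientGroup.mk' L) n
      rw [Subgroup.map_top_of_surjective _ (QuotientGroup.mk'_surjective L)] at this
      rw [← this, ← hLdef, Subgroup.map_eq_bot_iff, QuotientGroup.ker_mk']
    have hLfg : L.FG := by
      -- For `n = 0` the term is all of `G`, not a commutator, and is finitely generated by
      -- assumption.
      cases n with
      | zero =>
        rw [hLdef, Subgroup.lowerCentralSeries_zero]
        exact Group.fg_def.1 inferInstance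
      | succ m =>
        rw [Subgroup.lowerCentralSeries_succ] at hLdef
        have : ((⊤ : Subgroup G).lowerCentralSeries m).Normal := inferInstance
        clear_value L
        subst hLdef
        exact Subgroup.fg_commutator_top_of_le_center _ hLZ (hQ _)
    refine Subgroup.fg_of_fg_map_of_fg_inf_ker (QuotientGroup.mk' L) K (hQ _) ?_
    rw [QuotientGroup.ker_mk']
    exact Subgroup.fg_of_le_center_of_le hLZ hLfg inf_le_right

theorem Group.IsNilpotent.subgroup_fg {G : Type*} [Group G] [Group.FG G] [Group.IsNilpotent G]
    (K : Subgroup G) : K.FG := by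
  obtain ⟨n, hn⟩ := Subgroup.nilpotent_iff_lowerCentralSeries.1 ‹Group.IsNilpotent G›
  exact Subgroup.fg_of_lowerCentralSeries_eq_bot n G hn K

/-! ### Torsion in the centre -/

/-- If `x ^ n` is central and `c = y * x * y⁻¹ * x⁻¹` is central, then `c ^ n * x ^ n = (y * x *
y⁻¹) ^ n = x ^ n`, so `c ^ n = 1` and `c = 1`. -/
theorem Subgroup.center_quotient_center_torsionFree {G : Type*} [Group G]
    (h : ∀ z ∈ Subgroup.center G, ∀ n : ℕ, n ≠ 0 → z ^ n = 1 → z = 1) :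
    ∀ z ∈ Subgroup.center (G ⧸ Subgroup.center G), ∀ n : ℕ, n ≠ 0 → z ^ n = 1 → z = 1 := by
  intro z hz n hn hzn
  obtain ⟨x, rfl⟩ := QuotientGroup.mk_surjective z
  have hxn : x ^ n ∈ Subgroup.center G := (QuotientGroup.eq_one_iff _).1 hzn
  refine (QuotientGroup.eq_one_iff _).2 (Subgroup.mem_center_iff.2 fun y => ?_)
  have hc : y * x * y⁻¹ * x⁻¹ ∈ Subgroup.center G := by
    rw [← QuotientGroup.eq_one_iff]
    have := Subgroup.mem_center_iff.1 hz (y : G ⧸ Subgroup.center G)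
    rw [QuotientGroup.mk_mul, QuotientGroup.mk_mul, QuotientGroup.mk_mul, this]
    simp
  have hcomm : Commute (y * x * y⁻¹ * x⁻¹) x := (Subgroup.mem_center_iff.1 hc x).symm
  have h1 : (y * x * y⁻¹ * x⁻¹) ^ n * x ^ n = x ^ n := by
    rw [← hcomm.mul_pow, inv_mul_cancel_right, conj_pow, Subgroup.mem_center_iff.1 hxn y,
      mul_inv_cancel_right]
  have h2 := h _ hc n hn (mul_eq_right.1 h1)
  rwa [mul_inv_eq_one, mul_inv_eq_iff_eq_mul] at h2

/-! ### Reidemeister numbers of extensions and of abelian groups -/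

/-- The set of classes is nonempty, so `Nat.card` is `0` exactly when it is infinite. -/
theorem reidemeisterNumber_eq_of_natCard_eq {G K : Type*} [Group G] [Group K]
    {φ : Monoid.End G} {χ : Monoid.End K}
    (h : Nat.card (Quotient (twistedConjSetoid φ)) = Nat.card (Quotient (twistedConjSetoid χ))) :
    reidemeisterNumber φ = reidemeisterNumber χ := by
  have : Nonempty (Quotient (twistedConjSetoid φ)) := ⟨Quotient.mk _ 1⟩
  have : Nonempty (Quotient (twistedConjSetoid χ)) := ⟨Quotient.mk _ 1⟩
  unfold reidemeisterNumber
  rcases finite_or_infinite (Quotient (twistedConjSetoid φ)) with hf | hf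
  · have : Finite (Quotient (twistedConjSetoid χ)) :=
      Nat.finite_of_card_ne_zero (h ▸ Nat.card_pos.ne')
    rw [ENat.card_eq_coe_natCard, ENat.card_eq_coe_natCard, h]
  · have : Infinite (Quotient (twistedConjSetoid χ)) := by
      rw [Nat.card_eq_zero_of_infinite] at h
      rcases Nat.card_eq_zero.1 h.symm with h | h
      · exact (not_isEmpty_of_nonempty _ h).elim
      · exact h
    rw [ENat.card_eq_top_of_infinite, ENat.card_eq_top_of_infinite]

/-- The Reidemeister number is multiplicative in central extensions when all twisted stabilizers
in the quotient are trivial. -/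
theorem natCard_twistedConj_eq_mul {A G Q : Type*} [Group A] [Group G] [Group Q]
    {α : Monoid.End A} {φ : Monoid.End G} {β : Monoid.End Q} (i : A →* G) (p : G →* Q)
    (hi : Function.Injective i) (hp : Function.Surjective p) (hker : p.ker = i.range)
    (hcen : ∀ a g, i a * g = g * i a) (hα : ∀ a, φ (i a) = i (α a))
    (hβ : ∀ g, p (φ g) = β (p g))
    (hfix : ∀ x g : Q, g * x * (β g)⁻¹ = x → g = 1) :
    Nat.card (Quotient (twistedConjSetoid φ)) =
      Nat.card (Quotient (twistedConjSetoid α)) * Nat.card (Quotient (twistedConjSetoid β)) := by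
  rw [← Nat.card_prod]
  have hpi : ∀ a, p (i a) = 1 := fun a => by
    rw [← MonoidHom.mem_ker, hker]; exact ⟨a, rfl⟩
  let s : Q → G := Function.surjInv hp
  have hs : ∀ y, p (s y) = y := Function.surjInv_eq hp
  let F : Quotient (twistedConjSetoid α) × Quotient (twistedConjSetoid β) →
      Quotient (twistedConjSetoid φ) := fun c => Quotient.mk _ (i c.1.out * s c.2.out)
  refine (Nat.card_congr (Equiv.ofBijective F ⟨?_, ?_⟩)).symm
  · rintro ⟨a, b⟩ ⟨a', b'⟩ h
    obtain ⟨z, hz⟩ := Quotient.exact h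
    have hb : b = b' := by
      rw [← Quotient.out_eq b, ← Quotient.out_eq b']
      refine Quotient.sound ⟨p z, ?_⟩
      simpa [hpi, hs, hβ] using congrArg p hz
    subst hb
    -- `p z` fixes the representative of `b`; triviality of its stabilizer puts `z` in the image of
    -- `i`, so distinct `α`-classes do not merge.
    have hz1 : p z = 1 := by
      refine hfix b.out (p z) ?_
      simpa [hpi, hs, hβ] using (congrArg p hz).symm
    obtain ⟨w, rfl⟩ : z ∈ i.range := hker ▸ hz1
    refine Prod.ext ?_ rfl
    rw [← Quotient.out_eq a, ← Quotient.out_eq a']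
    refine Quotient.sound ⟨w, hi ?_⟩
    have h2 : i a.out * s b.out = i (w * a'.out * (α w)⁻¹) * s b.out := by
      dsimp only at hz
      have hc : (i (α w))⁻¹ * s b.out = s b.out * (i (α w))⁻¹ := by
        rw [← map_inv]; exact hcen _ _
      rw [hz, hα, map_mul, map_mul, map_inv]
      simp only [mul_assoc, hc]
    exact mul_right_cancel h2
  · intro c
    induction c using Quotient.inductionOn with | _ g =>
    let b : Quotient (twistedConjSetoid β) := Quotient.mk _ (p g)
    obtain ⟨y, hy⟩ : ∃ y, b.out = y * p g * (β y)⁻¹ :=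
      Quotient.mk_out (s := twistedConjSetoid β) (p g)
    obtain ⟨z, rfl⟩ := hp y
    have hmem : z * g * (φ z)⁻¹ * (s b.out)⁻¹ ∈ i.range := by
      rw [← hker, MonoidHom.mem_ker]
      simp only [map_mul, map_inv, hs, hβ]
      rw [← hy, mul_inv_cancel]
    obtain ⟨a, ha⟩ := hmem
    obtain ⟨w, hw⟩ : ∃ w, (Quotient.mk (twistedConjSetoid α) a).out = w * a * (α w)⁻¹ :=
      Quotient.mk_out (s := twistedConjSetoid α) a
    refine ⟨(Quotient.mk _ a, b), Quotient.sound ⟨i w * z, ?_⟩⟩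
    dsimp only
    rw [hw, map_mul, map_mul, map_mul, map_inv, mul_inv_rev, hα, mul_assoc (i w * i a), ← map_inv,
      hcen (α w)⁻¹, ha]
    simp [mul_assoc]

/-- Rank-nullity over `ℤ`: the cokernel is torsion, so the range has full rank, and the kernel has
rank `0`, hence is torsion, hence trivial. -/
theorem MonoidHom.injective_of_index_range_ne_zero {A : Type*} [CommGroup A] [Group.FG A]
    (htf : ∀ a : A, ∀ n : ℕ, n ≠ 0 → a ^ n = 1 → a = 1) (f : A →* A)
    (hf : f.range.index ≠ 0) : Function.Injective f := by
  have : Module.Finite ℤ (Additive A) := by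
    rw [Module.Finite.iff_addGroup_fg]
    infer_instance
  let F : Additive A →ₗ[ℤ] Additive A := f.toAdditive.toIntLinearMap
  have hann : ∀ x : Additive A, f.range.index • x ∈ LinearMap.range F := by
    intro x
    obtain ⟨y, hy⟩ := Subgroup.pow_index_mem f.range x.toMul
    exact ⟨Additive.ofMul y, hy⟩
  have h1 : Module.finrank ℤ (Additive A ⧸ LinearMap.range F) = 0 := by
    rw [Module.finrank_eq_zero_iff]
    intro x
    obtain ⟨x, rfl⟩ := Submodule.Quotient.mk_surjective _ x
    refine ⟨(f.range.index : ℤ), by exact_mod_cast hf, ?_⟩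
    rw [← Submodule.Quotient.mk_smul, Submodule.Quotient.mk_eq_zero, natCast_zsmul]
    exact hann x
  have h2 := Submodule.finrank_quotient_add_finrank (LinearMap.range F)
  have h3 := (LinearMap.ker F).finrank_quotient_add_finrank
  rw [F.quotKerEquivRange.finrank_eq] at h3
  have h4 : Module.finrank ℤ (LinearMap.ker F) = 0 := by omega
  rw [Module.finrank_eq_zero_iff] at h4
  rw [injective_iff_map_eq_one]
  intro a ha
  obtain ⟨n, hn, hna⟩ := h4 ⟨Additive.ofMul a, ha⟩
  have hna' : a ^ n = 1 := congrArg Subtype.val hna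
  refine htf a n.natAbs (by simpa using hn) ?_
  rcases Int.natAbs_eq n with h | h
  · rw [h] at hna'; simpa using hna'
  · rw [h] at hna'; simpa using hna'

theorem natCard_twistedConj_subgroup {A : Type*} [CommGroup A] (α : Monoid.End A) (f : A →* A)
    (hf : ∀ a, f a = a * (α a)⁻¹) (B : Subgroup A) (β : Monoid.End B)
    (hβ : ∀ b, (β b : A) = α b) :
    Nat.card (Quotient (twistedConjSetoid β)) = (B.map f).relIndex B := by
  rw [Subgroup.relIndex, Subgroup.index]
  refine Nat.card_congr (Quotient.congr (Equiv.refl _) fun x y => ?_)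
  rw [QuotientGroup.leftRel_apply]
  change (∃ z : B, x = z * y * (β z)⁻¹) ↔ _
  rw [Subgroup.mem_subgroupOf, Subgroup.mem_map]
  constructor
  · rintro ⟨z, hz⟩
    -- Twisted conjugacy gives `x * y⁻¹ = f z`, while left cosets compare `x⁻¹ * y`; hence the
    -- inverse.
    refine ⟨(z : A)⁻¹, B.inv_mem z.2, ?_⟩
    rw [Equiv.refl_apply, Equiv.refl_apply, hz]
    change f (z : A)⁻¹ = ((z * y * (β z)⁻¹ : B) : A)⁻¹ * y
    rw [map_inv, hf, Subgroup.coe_mul, Subgroup.coe_mul, Subgroup.coe_inv, hβ, mul_inv, mul_inv,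
      mul_inv, mul_right_comm, inv_mul_cancel_right]
  · rintro ⟨z, hz, h⟩
    refine ⟨⟨z, hz⟩⁻¹, Subtype.ext ?_⟩
    have h' : z * (α z)⁻¹ = (x : A)⁻¹ * y := by rw [← hf]; exact h
    have : (α z)⁻¹ = z⁻¹ * ((x : A)⁻¹ * y) := by rw [← h']; simp
    simp only [Subgroup.coe_mul, Subgroup.coe_inv, hβ, map_inv, inv_inv]
    rw [inv_eq_iff_eq_inv] at this
    rw [this]
    simp [mul_comm, mul_left_comm]

theorem natCard_twistedConj_eq_index {A : Type*} [CommGroup A] (α : Monoid.End A) (f : A →* A)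
    (hf : ∀ a, f a = a * (α a)⁻¹) :
    Nat.card (Quotient (twistedConjSetoid α)) = (f.range).index := by
  rw [Subgroup.index]
  refine Nat.card_congr (Quotient.congr (Equiv.refl _) fun x y => ?_)
  rw [QuotientGroup.leftRel_apply]
  change (∃ z : A, x = z * y * (α z)⁻¹) ↔ ∃ z, f z = x⁻¹ * y
  constructor
  · rintro ⟨z, rfl⟩
    exact ⟨z⁻¹, by
      rw [map_inv, hf, mul_inv, mul_inv, mul_inv, mul_right_comm, inv_mul_cancel_right]⟩
  · rintro ⟨z, h⟩
    refine ⟨z⁻¹, ?_⟩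
    rw [hf] at h
    rw [map_inv, inv_inv, ← inv_inj]
    have : (α z)⁻¹ = z⁻¹ * (x⁻¹ * y) := by rw [← h]; simp
    rw [mul_inv, mul_inv, this]
    simp [mul_comm, mul_left_comm]

/-- Compute the index of `B.map f` in `A` through `B` and through `f.range`. For injective `f`, the
index of `B.map f` in `f.range` is `B.index`, which cancels. -/
theorem Subgroup.relIndex_map_eq_index_range {A : Type*} [CommGroup A] [Group.FG A]
    (htf : ∀ a : A, ∀ n : ℕ, n ≠ 0 → a ^ n = 1 → a = 1) (f : A →* A) (B : Subgroup A)
    [B.FiniteIndex] (hB : B.map f ≤ B) : (B.map f).relIndex B = f.range.index := by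
  have hle : B.map f ≤ f.range := Subgroup.map_le_range f B
  have h1 := Subgroup.relIndex_mul_index hB
  have h2 := Subgroup.relIndex_mul_index hle
  have hBi : B.index ≠ 0 := Subgroup.FiniteIndex.index_ne_zero
  by_cases hf : Function.Injective f
  · have h3 : (B.map f).relIndex f.range = B.index := by
      rw [MonoidHom.range_eq_map, Subgroup.relIndex_map_map_of_injective _ _ hf,
        Subgroup.relIndex_top_right]
    rw [h3, ← h1, mul_comm] at h2
    exact (Nat.eq_of_mul_eq_mul_right (Nat.pos_of_ne_zero hBi) (by rw [← h2, mul_comm])).symm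
  -- Index `0` means infinite: without injectivity both sides are `0`.
  · have h0 : f.range.index = 0 := by
      by_contra h
      exact hf (f.injective_of_index_range_ne_zero htf h)
    rw [h0, mul_zero] at h2
    rw [← h2] at h1
    rw [h0]
    exact (mul_eq_zero.1 h1).resolve_right hBi

/-! ### Automorphisms of finitely generated nilpotent groups -/

/-- Every automorphism with finite Reidemeister number has trivial twisted stabilizers, and
restricting an automorphism to an invariant subgroup of
finite index does not change the Reidemeister number. -/
def ReidemeisterRigid (G : Type*) [Group G] : Prop :=
  ∀ φ : MulAut G,
    (Nat.card (Quotient (twistedConjSetoid (φ.toMonoidHom : Monoid.End G))) ≠ 0 →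
      ∀ x g : G, g * x * (φ g)⁻¹ = x → g = 1) ∧
    ∀ (H : Subgroup G) [H.FiniteIndex] (χ : Monoid.End H), (∀ x, (χ x : G) = φ x) →
      Nat.card (Quotient (twistedConjSetoid χ)) =
        Nat.card (Quotient (twistedConjSetoid (φ.toMonoidHom : Monoid.End G)))

theorem reidemeisterRigid_of_subsingleton (G : Type*) [Group G] [Subsingleton G] :
    ReidemeisterRigid G := by
  refine fun φ => ⟨fun _ x g _ => Subsingleton.elim _ _, fun H _ χ _ => ?_⟩
  have h1 : ∀ (K : Type _) [Group K] [Subsingleton K] (κ : Monoid.End K),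
      Nat.card (Quotient (twistedConjSetoid κ)) = 1 := fun K _ _ κ => by
    rw [Nat.card_eq_one_iff_unique]
    exact ⟨inferInstance, ⟨Quotient.mk _ 1⟩⟩
  exact (h1 H χ).trans (h1 G φ.toMonoidHom).symm

theorem natCard_twistedConj_ne_zero_of_surjective {G Q : Type*} [Group G] [Group Q]
    {φ : Monoid.End G} {β : Monoid.End Q} (p : G →* Q) (hp : Function.Surjective p)
    (hβ : ∀ g, p (φ g) = β (p g)) (h : Nat.card (Quotient (twistedConjSetoid φ)) ≠ 0) :
    Nat.card (Quotient (twistedConjSetoid β)) ≠ 0 := by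
  have := Nat.finite_of_card_ne_zero h
  have hsurj : Function.Surjective (Quotient.map (sa := twistedConjSetoid φ)
      (sb := twistedConjSetoid β) p (by
        rintro x y ⟨z, rfl⟩
        exact ⟨p z, by simp [hβ]⟩)) := by
    intro c
    induction c using Quotient.inductionOn with | _ y =>
    obtain ⟨x, rfl⟩ := hp y
    exact ⟨Quotient.mk _ x, rfl⟩
  have := Finite.of_surjective _ hsurj
  have : Nonempty (Quotient (twistedConjSetoid β)) := ⟨Quotient.mk _ 1⟩
  exact Nat.card_pos.ne'

open Subgroup IsMulCommutative in
/-- Rigidity passes from the central quotient to the group. -/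
theorem reidemeisterRigid_of_quotient_center {G : Type*} [Group G]
    (hfg : (center G).FG)
    (htf : ∀ z ∈ center G, ∀ n : ℕ, n ≠ 0 → z ^ n = 1 → z = 1)
    (ih : ReidemeisterRigid (G ⧸ center G)) : ReidemeisterRigid G := by
  intro φ
  let q : G →* G ⧸ center G := QuotientGroup.mk' (center G)
  have hq : Function.Surjective q := QuotientGroup.mk'_surjective (center G)
  let ψ : MulAut (G ⧸ center G) := QuotientGroup.congr (center G) (center G) φ
    (Subgroup.characteristic_iff_map_eq.1 inferInstance φ)
  have hψ : ∀ g, q (φ g) = ψ (q g) := fun g => rfl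
  obtain ⟨ih1, ih2⟩ := ih ψ
  let φE : Monoid.End G := φ.toMonoidHom
  let ψE : Monoid.End (G ⧸ center G) := ψ.toMonoidHom
  let α : Monoid.End (center G) := (MulAut.characteristic (center G) φ).toMonoidHom
  have hα : ∀ a : ↥(center G), (α a : G) = φ a := fun a => rfl
  have : Group.FG (center G) := (Group.fg_iff_subgroup_fg (center G)).2 hfg
  have htfZ : ∀ a : ↥(center G), ∀ n : ℕ, n ≠ 0 → a ^ n = 1 → a = 1 := fun a n hn h =>
    Subtype.ext (htf a a.2 n hn (congrArg Subtype.val h))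
  let f : ↥(center G) →* ↥(center G) := MonoidHom.mk' (fun a => a * (α a)⁻¹) fun a b => by
    rw [map_mul, mul_inv, mul_mul_mul_comm]
  have hf : ∀ a, f a = a * (α a)⁻¹ := fun a => rfl
  have hαcard := natCard_twistedConj_eq_index α f hf
  have hmul : Nat.card (Quotient (twistedConjSetoid ψE)) ≠ 0 →
      Nat.card (Quotient (twistedConjSetoid φE)) =
      Nat.card (Quotient (twistedConjSetoid α)) * Nat.card (Quotient (twistedConjSetoid ψE)) :=
    fun h => natCard_twistedConj_eq_mul (center G).subtype q Subtype.val_injective hq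
      (by rw [QuotientGroup.ker_mk', Subgroup.range_subtype])
      (fun a g => (Subgroup.mem_center_iff.1 a.2 g).symm) (fun a => (hα a).symm) hψ (ih1 h)
  refine ⟨fun h x g hgx => ?_, fun H _ χ hχ => ?_⟩
  · have h' := natCard_twistedConj_ne_zero_of_surjective (φ := φE) (β := ψE) q hq hψ h
    have hg : g ∈ center G := by
      rw [← QuotientGroup.eq_one_iff]
      refine ih1 h' (q x) (q g) ?_
      rw [← hψ, ← map_mul, ← map_inv, ← map_mul, hgx]
    -- Finiteness of `R(φ)` passes to the factor on the centre, which makes `f` injective and kills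
    -- the central element `g`.
    have hne : f.range.index ≠ 0 := by
      rw [← hαcard]
      exact left_ne_zero_of_mul (hmul h' ▸ h)
    have hinj := f.injective_of_index_range_ne_zero htfZ hne
    have : f ⟨g, hg⟩ = f 1 := by
      rw [map_one]
      refine Subtype.ext ?_
      change g * (φ g)⁻¹ = 1
      rw [← Subgroup.mem_center_iff.1 hg x, mul_assoc] at hgx
      exact mul_eq_left.1 hgx
    exact congrArg Subtype.val (hinj this)
  · let K : Subgroup (G ⧸ center G) := H.map q
    let p : H →* K := q.subgroupMap H
    have hp : Function.Surjective p := q.subgroupMap_surjective H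
    have hφH : ∀ x ∈ H, φ x ∈ H := fun x hx => hχ ⟨x, hx⟩ ▸ (χ ⟨x, hx⟩).2
    have hψK : ∀ y ∈ K, ψ y ∈ K := by
      rintro _ ⟨x, hx, rfl⟩
      exact ⟨φ x, hφH x hx, rfl⟩
    let β : Monoid.End K := (ψ.toMonoidHom.comp K.subtype).codRestrict K fun y => hψK y y.2
    have hβ : ∀ y, (β y : G ⧸ center G) = ψ y := fun y => rfl
    have hβp : ∀ g, p (χ g) = β (p g) := fun g => Subtype.ext (by
      change q (χ g) = ψ (q g)
      rw [hχ, hψ])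
    have : K.FiniteIndex := ⟨fun h => Subgroup.FiniteIndex.index_ne_zero (H := H)
      (Nat.eq_zero_of_zero_dvd (h ▸ Subgroup.index_map_dvd H hq))⟩
    have hK := ih2 K β hβ
    by_cases h : Nat.card (Quotient (twistedConjSetoid ψE)) = 0
    · have h1 : Nat.card (Quotient (twistedConjSetoid φE)) = 0 := by
        by_contra hne
        exact natCard_twistedConj_ne_zero_of_surjective q hq hψ hne h
      have h2 : Nat.card (Quotient (twistedConjSetoid χ)) = 0 := by
        by_contra hne
        exact natCard_twistedConj_ne_zero_of_surjective p hp hβp hne (hK.trans h)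
      exact h2.trans h1.symm
    -- `H` is a central extension of `K` by `B`. It need not be known that `B` is the whole centre
    -- of `H`.
    · let B : Subgroup (center G) := H.subgroupOf (center G)
      have hαB : ∀ b ∈ B, α b ∈ B := fun b hb => hφH b hb
      let γ : Monoid.End B := (MonoidHom.comp α B.subtype).codRestrict B fun b => hαB b b.2
      have hγ : ∀ b, (γ b : center G) = α b := fun b => rfl
      let i : B →* H := ((center G).subtype.comp B.subtype).codRestrict H fun b => b.2
      have hi : ∀ b, (i b : G) = (b : center G) := fun b => rfl
      have hmulH : Nat.card (Quotient (twistedConjSetoid χ)) =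
          Nat.card (Quotient (twistedConjSetoid γ)) * Nat.card (Quotient (twistedConjSetoid β)) := by
        refine natCard_twistedConj_eq_mul i p
          (fun a b hab => Subtype.ext (Subtype.ext (show (i a : G) = i b by rw [hab])))
          hp ?_
          (fun a g => Subtype.ext (Subgroup.mem_center_iff.1 (a : center G).2 g).symm)
          (fun a => Subtype.ext (hχ _)) hβp ?_
        · ext x
          constructor
          · intro hx
            have hxZ : (x : G) ∈ center G :=
              (QuotientGroup.eq_one_iff _).1 (congrArg Subtype.val (MonoidHom.mem_ker.1 hx))
            exact ⟨⟨⟨x, hxZ⟩, x.2⟩, rfl⟩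
          · rintro ⟨b, rfl⟩
            exact Subtype.ext ((QuotientGroup.eq_one_iff _).2 (b : center G).2)
        · exact fun x g hxg => Subtype.ext (ih1 h x g (congrArg Subtype.val hxg))
      have hBf : B.map f ≤ B := by
        rintro _ ⟨b, hb, rfl⟩
        exact B.mul_mem hb (B.inv_mem (hαB b hb))
      have hγα : Nat.card (Quotient (twistedConjSetoid γ)) =
          Nat.card (Quotient (twistedConjSetoid α)) := by
        rw [natCard_twistedConj_subgroup α f hf B γ hγ, hαcard]
        exact Subgroup.relIndex_map_eq_index_range htfZ f B hBf
      rw [hmulH, hγα, hK]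
      exact (hmul h).symm

/-- Only torsion-freeness of the centre is carried along, as this is the property shown to pass to
`G ⧸ center G`. -/
theorem Group.IsNilpotent.reidemeisterRigid (G : Type*) [Group G] [Group.IsNilpotent G] :
    Group.FG G → (∀ z ∈ Subgroup.center G, ∀ n : ℕ, n ≠ 0 → z ^ n = 1 → z = 1) →
      ReidemeisterRigid G := by
  refine Group.nilpotent_center_quotient_ind (P := fun G _ _ => Group.FG G →
    (∀ z ∈ Subgroup.center G, ∀ n : ℕ, n ≠ 0 → z ^ n = 1 → z = 1) → ReidemeisterRigid G) G
    (fun G _ _ _ _ => reidemeisterRigid_of_subsingleton G) fun G _ _ ih hfg htf => ?_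
  exact reidemeisterRigid_of_quotient_center (Group.IsNilpotent.subgroup_fg _) htf
    (ih inferInstance (Subgroup.center_quotient_center_torsionFree htf))

theorem reidemeisterSpectrum_subset (G : Type*) [Group G] :
    reidemeisterSpectrum G ⊆ {n : ℕ∞ | ∃ k : ℕ, 1 ≤ k ∧ n = (k : ℕ∞)} ∪ {⊤} := by
  rintro _ ⟨ψ, rfl⟩
  have : Nonempty (Quotient (twistedConjSetoid (ψ.toMonoidHom : Monoid.End G))) :=
    ⟨Quotient.mk _ 1⟩
  unfold reidemeisterNumber
  rcases finite_or_infinite (Quotient (twistedConjSetoid (ψ.toMonoidHom : Monoid.End G)))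
  · exact Or.inl ⟨_, Nat.card_pos, ENat.card_eq_coe_natCard _⟩
  · exact Or.inr (ENat.card_eq_top_of_infinite)

theorem mainTheorem8 {N : Type*} [Group N] [Group.FG N] [Group.IsNilpotent N]
    (htf : IsTorsionFreeGroup N)
    (H : Subgroup N) (hchar : H.Characteristic) (hfin : H.FiniteIndex) :
    reidemeisterSpectrum N ⊆ reidemeisterSpectrum H ∧
      (HasFullReidemeisterSpectrum N → HasFullReidemeisterSpectrum H) := by
  have hsub : reidemeisterSpectrum N ⊆ reidemeisterSpectrum H := by
    rintro _ ⟨ψ, rfl⟩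
    refine ⟨MulAut.characteristic H ψ, reidemeisterNumber_eq_of_natCard_eq ?_⟩
    refine (Group.IsNilpotent.reidemeisterRigid N inferInstance (fun z _ n hn h => ?_) ψ).2 H _
      fun x => rfl
    exact htf z (isOfFinOrder_iff_pow_eq_one.2 ⟨n, Nat.pos_of_ne_zero hn, h⟩)
  exact ⟨hsub, fun hN => (reidemeisterSpectrum_subset H).antisymm
    (Eq.symm hN ▸ hsub)⟩
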